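/- All cardinal functions take infinite values: for a topological space $Y$, the network weight $nw(Y)$ is the smallest infinite cardinal $\kappa$ such that $Y$ has a network of cardinality at most $\kappa$, where a network of $Y$ is a family $\mathcal N$ of subsets of $Y$ such that for every open $U\subset Y$ and every $y\in U$ there is $S\in\mathcal N$ with $y\in S\subset U$. A space $X$ has countable tightness if every point in the closure of a set $A\subset X$ lies in the closure of some countable subset of $A$. A function $f:X\to\mathbb R$ is scatteredly continuous if for every non-empty $A\subset X$ the restriction $f|A$ has a point of continuity; $SC_p(X)\subset\mathbb R^X$ is the space of all scatteredly continuous functions $f:X\to\mathbb R$ with the topology of pointwise convergence, and $C_p(X)\subset SC_p(X)$ is its subspace of continuous functions. A subset $C$ of a real linear topological space is $\sigma$-convex if for every sequence $(x_n)_{n\ge 0}$ in $C$ and every sequence $(t_n)_{n\ge 0}$ of positive reals with $\sum_{n=0}^\infty t_n=1$ the series $\sum_{n=0}^\infty t_nx_n$ converges to some point of $C$. Let $X$ be a topological space of countable tightness. Then every $\sigma$-convex subset $F\subset SC_p(X)$ (with the subspace topology) satisfies $nw(F)\le nw(X)$. If, moreover, $X$ is Tychonoff, then $$nw(X)=\max\{nw(F):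 F \text{ is a } \sigma\text{-convex subset of } SC_p(X)\},$$ and the maximum is attained by the closed unit ball $\{f\in C_p(X): |f(x)|\le 1\text{ for all }x\in X\}$, which is a $\sigma$-convex subset of $SC_p(X)$. -/

import Mathlib

open Filter Topology Cardinal

universe u v

/-- A network of a topological space: a family of (arbitrary) subsets such that every open
neighbourhood of every point contains a member of the family that contains the point. -/
def IsNetwork {Y : Type u} [TopologicalSpace Y] (N : Set (Set Y)) : Prop :=
  ∀ (y : Y) (U : Set Y), IsOpen U → y ∈ U → ∃ S ∈ N, y ∈ S ∧ S ⊆ U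

/-- The network weight `nw(Y)`: the smallest infinite cardinal `κ` such that `Y` has a network of
cardinality at most `κ` (as usual for cardinal functions, its values are infinite). -/
noncomputable def networkWeight (Y : Type u) [TopologicalSpace Y] : Cardinal.{u} :=
  sInf {κ : Cardinal.{u} | ℵ₀ ≤ κ ∧ ∃ N : Set (Set Y), IsNetwork N ∧ #N ≤ κ}

/-- The tightness `t(X)`: the smallest infinite cardinal `κ` such that each point in the closure
of a set `A` is in the closure of a subset of `A` of cardinality at most `κ`. -/
noncomputable def tightness (X : Type u) [TopologicalSpace X] : Cardinal.{u} :=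
  sInf {κ : Cardinal.{u} | ℵ₀ ≤ κ ∧
    ∀ (A : Set X), ∀ a ∈ closure A, ∃ B ⊆ A, #B ≤ κ ∧ a ∈ closure B}

/-- A function is scatteredly continuous if its restriction to each nonempty subspace has a point
of continuity. -/
def ScatteredlyContinuous {X : Type u} {Y : Type v} [TopologicalSpace X] [TopologicalSpace Y]
    (f : X → Y) : Prop :=
  ∀ A : Set X, A.Nonempty → ∃ a ∈ A, ContinuousWithinAt f A a

/-- The underlying set of `SC_p(X)`, as a subset of `X → ℝ`; the product topology of `X → ℝ` is
the topology of pointwise convergence, and subsets carry the subspace topology. -/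
def SCp (X : Type u) [TopologicalSpace X] : Set (X → ℝ) :=
  {f | ScatteredlyContinuous f}

/-- The closed unit ball `{f ∈ C_p(X) : sup |f| ≤ 1}` of the space of continuous functions. -/
def cpUnitBall (X : Type u) [TopologicalSpace X] : Set (X → ℝ) :=
  {f | Continuous f ∧ ∀ x, |f x| ≤ 1}

/-- A subset `C` of a real topological vector space is `σ`-convex if for all sequences `x n` in `C`
and all sequences of positive reals `t n` with sum `1`, the series `∑ t n • x n` converges
(in the sense of partial sums) to a point of `C`. -/
def IsSigmaConvex {L : Type u} [AddCommGroup L] [Module ℝ L] [TopologicalSpace L]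
    (C : Set L) : Prop :=
  ∀ (x : ℕ → L) (t : ℕ → ℝ), (∀ n, x n ∈ C) → (∀ n, 0 < t n) → HasSum t 1 →
    ∃ c ∈ C, Tendsto (fun n => ∑ i ∈ Finset.range n, t i • x i) atTop (𝓝 c)

/-! A σ-convex `F` is pointwise bounded, so `X` is a countable union of sets on which `F` is
uniformly bounded. On such a set, every nonempty `A` has a nonempty relatively open part where all
of `F` is continuous (`exists_isOpen_forall_continuousOn`). Otherwise countable tightness gives a
countable nonempty `Q ⊆ A`, each point of which is a discontinuity on `Q` of some member of `F`. A
Baire argument on coefficients merges these members into one σ-convex combination discontinuous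
everywhere on `Q`, which is not scatteredly continuous. Exhaustion then covers `X` by `nw(X)` pieces
on which all of `F` is continuous, and `networkWeight_le_of_isInducing` turns this cover into a
network of `F`. The same lemma, applied to evaluations on the unit ball, gives the reverse bound. -/

theorem aleph0_le_networkWeight_and_exists (Y : Type u) [TopologicalSpace Y] :
    ℵ₀ ≤ networkWeight Y ∧ ∃ N : Set (Set Y), IsNetwork N ∧ #N ≤ networkWeight Y := by
  have hne : {κ : Cardinal.{u} | ℵ₀ ≤ κ ∧ ∃ N : Set (Set Y), IsNetwork N ∧ #N ≤ κ}.Nonempty :=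
    ⟨max ℵ₀ #(Set.univ : Set (Set Y)), le_max_left _ _, Set.univ,
      fun y U _ hy => ⟨U, Set.mem_univ _, hy, subset_rfl⟩, le_max_right _ _⟩
  exact csInf_mem hne

theorem networkWeight_le_of_isNetwork {Y : Type u} [TopologicalSpace Y] {κ : Cardinal.{u}}
    (hκ : ℵ₀ ≤ κ) {N : Set (Set Y)} (hN : IsNetwork N) (hc : #N ≤ κ) : networkWeight Y ≤ κ :=
  csInf_le' ⟨hκ, N, hN, hc⟩

theorem exists_countable_subset_mem_closure {X : Type u} [TopologicalSpace X]
    (hX : tightness X ≤ ℵ₀) {A : Set X} {a : X} (ha : a ∈ closure A) :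
    ∃ B ⊆ A, B.Countable ∧ a ∈ closure B := by
  have hne : {κ : Cardinal.{u} | ℵ₀ ≤ κ ∧
      ∀ (A : Set X), ∀ a ∈ closure A, ∃ B ⊆ A, #B ≤ κ ∧ a ∈ closure B}.Nonempty :=
    ⟨max ℵ₀ #X, le_max_left _ _, fun A a ha =>
      ⟨A, subset_rfl, (mk_set_le A).trans (le_max_right _ _), ha⟩⟩
  obtain ⟨B, hBA, hB, haB⟩ := (csInf_mem hne).2 A a ha
  exact ⟨B, hBA, le_aleph0_iff_set_countable.1 (hB.trans hX), haB⟩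

/-! ### Networks of function spaces -/

/-- If the topology of `Z` is induced by a family of real functions on `Y`, all of them continuous
on each member of a cover of `Y`, then `nw(Z)` is bounded by `nw(Y)` and the size of the cover. -/
theorem networkWeight_le_of_isInducing {Z Y : Type u} [TopologicalSpace Z] [TopologicalSpace Y]
    {φ : Z → Y → ℝ} (hφ : IsInducing φ) {κ : Cardinal.{u}} (hκ : networkWeight Y ≤ κ)
    {P : Set (Set Y)} (hP : #P ≤ κ) (hcov : ∀ y, ∃ p ∈ P, y ∈ p)
    (hc : ∀ p ∈ P, ∀ z, ContinuousOn (φ z) p) : networkWeight Z ≤ κ := by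
  obtain ⟨h0, N, hN, hNc⟩ := aleph0_le_networkWeight_and_exists Y
  have h0κ := h0.trans hκ
  -- Continuity on `p` spreads a condition at one point to a whole piece `S ∩ p`, so finite lists of
  -- such conditions suffice.
  let W : List (P × N × ℚ × ℚ) → Set Z := fun T =>
    {z | ∀ τ ∈ T, ∀ y ∈ (τ.2.1 : Set Y) ∩ τ.1, φ z y ∈ Set.Ioo (τ.2.2.1 : ℝ) τ.2.2.2}
  refine networkWeight_le_of_isNetwork h0κ (N := Set.range W) ?_ ?_
  · intro z U hU hz
    obtain ⟨V, hV, rfl⟩ := hφ.isOpen_iff.1 hU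
    obtain ⟨I, u, hu, hIu⟩ := isOpen_pi_iff.1 hV (φ z) hz
    have key : ∀ y : I, ∃ τ : P × N × ℚ × ℚ, (y : Y) ∈ (τ.2.1 : Set Y) ∩ τ.1 ∧
        (∀ w ∈ (τ.2.1 : Set Y) ∩ τ.1, φ z w ∈ Set.Ioo (τ.2.2.1 : ℝ) τ.2.2.2) ∧
        Set.Ioo (τ.2.2.1 : ℝ) τ.2.2.2 ⊆ u y := by
      intro y
      obtain ⟨p, hp, hyp⟩ := hcov y
      obtain ⟨huo, hyu⟩ := hu y y.2
      obtain ⟨ε, hε, hball⟩ := Metric.isOpen_iff.1 huo _ hyu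
      rw [Real.ball_eq_Ioo] at hball
      obtain ⟨a, ha1, ha2⟩ := exists_rat_btwn (sub_lt_self (φ z y) hε)
      obtain ⟨b, hb1, hb2⟩ := exists_rat_btwn (lt_add_of_pos_right (φ z y) hε)
      have hnh : φ z ⁻¹' Set.Ioo (a : ℝ) b ∈ 𝓝[p] (y : Y) :=
        (hc p hp z y hyp) (Ioo_mem_nhds ha2 hb1)
      obtain ⟨O, hO, hyO, hOs⟩ := mem_nhdsWithin.1 hnh
      obtain ⟨S, hS, hyS, hSO⟩ := hN y O hO hyO
      exact ⟨(⟨p, hp⟩, ⟨S, hS⟩, a, b), ⟨hyS, hyp⟩, fun w hw => hOs ⟨hSO hw.1, hw.2⟩,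
        (Set.Ioo_subset_Ioo ha1.le hb2.le).trans hball⟩
    choose τ h1 h2 h3 using key
    refine ⟨W ((Finset.univ : Finset I).toList.map τ), ⟨_, rfl⟩, ?_, ?_⟩
    · intro t ht
      obtain ⟨y, -, rfl⟩ := List.mem_map.1 ht
      exact h2 y
    · intro z' hz'
      refine hIu fun y hy => h3 ⟨y, hy⟩ (hz' _ (List.mem_map.2 ⟨⟨y, hy⟩, ?_, rfl⟩) _ (h1 ⟨y, hy⟩))
      simp
  · refine mk_range_le.trans ((mk_list_le_max _).trans (max_le h0κ ?_))
    simp only [mk_prod, lift_id, lift_mul, lift_uzero]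
    refine mul_le_of_le h0κ hP (mul_le_of_le h0κ (hNc.trans hκ) (mul_le_of_le h0κ ?_ ?_)) <;>
      simpa using h0κ

/-! ### σ-convex sets of functions and their common continuity -/

theorem IsSigmaConvex.exists_abs_le {X : Type u} {F : Set (X → ℝ)} (hF : IsSigmaConvex F) (x : X) :
    ∃ n : ℕ, ∀ f ∈ F, |f x| ≤ n := by
  by_contra! h
  -- Against the weights `(1/2)^(n+1)`, every term at `x` exceeds `1` in absolute value, so the
  -- series diverges.
  choose f hf hfx using fun n : ℕ => h (2 ^ (n + 1))
  have ht : HasSum (fun n : ℕ => (1 / 2 : ℝ) ^ (n + 1)) 1 := by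
    simpa [pow_succ, div_eq_mul_inv] using hasSum_geometric_two.mul_right (1 / 2 : ℝ)
  obtain ⟨c, -, hc⟩ := hF f _ hf (fun n => by positivity) ht
  have hcx := tendsto_pi_nhds.1 hc x
  have hd := ((tendsto_add_atTop_iff_nat 1).2 hcx).sub hcx
  simp only [Finset.sum_range_succ, Pi.add_apply, add_sub_cancel_left, sub_self, Pi.smul_apply,
    smul_eq_mul] at hd
  obtain ⟨n, hn⟩ := (Metric.tendsto_nhds.1 hd 1 one_pos).exists
  have h1 := hfx n
  rw [Real.dist_eq, sub_zero, abs_mul, abs_of_pos (by positivity)] at hn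
  push_cast at h1
  have h2 : (1 / 2 : ℝ) ^ (n + 1) * 2 ^ (n + 1) = 1 := by rw [← mul_pow]; norm_num
  have h3 : (0 : ℝ) < (1 / 2) ^ (n + 1) := by positivity
  nlinarith

/-- Suppose that `g n` is a uniformly bounded sequence of functions on `Q` such that `g n` is
discontinuous at the point `x n`. Then some convergent series `∑ s n * g n` with positive
coefficients is discontinuous at all points `x n`. -/
theorem exists_series_not_continuousAt {Q : Type u} [TopologicalSpace Q] {g : ℕ → Q → ℝ} {C : ℝ}
    (hC : ∀ n y, |g n y| ≤ C) {x : ℕ → Q} (hx : ∀ n, ¬ ContinuousAt (g n) (x n)) :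
    ∃ s : ℕ → ℝ, (∀ n, 0 < s n) ∧ Summable s ∧
      ∀ n, ¬ ContinuousAt (fun y => ∑' i, s i * g i y) (x n) := by
  -- A compact Hausdorff, hence Baire, space of coefficients; the lower bound `1` keeps the weights
  -- positive.
  let K := ℕ → Set.Icc (1 : ℝ) 2
  let w : K → ℕ → ℝ := fun a n => (a n : ℝ) * (1 / 2) ^ n
  have hwpos : ∀ a n, 0 < w a n := fun a n =>
    mul_pos (one_pos.trans_le (a n).2.1) (by positivity)
  have hwle : ∀ a n, w a n ≤ 2 * (1 / 2) ^ n := fun a n =>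
    mul_le_mul_of_nonneg_right (a n).2.2 (by positivity)
  have hgeo : Summable fun n : ℕ => (2 : ℝ) * (1 / 2) ^ n := summable_geometric_two.mul_left 2
  have hwsum : ∀ a, Summable (w a) := fun a =>
    Summable.of_nonneg_of_le (fun n => (hwpos a n).le) (hwle a) hgeo
  have hterm : ∀ a y n, ‖w a n * g n y‖ ≤ 2 * (1 / 2) ^ n * C := fun a y n => by
    rw [norm_mul, Real.norm_of_nonneg (hwpos a n).le, Real.norm_eq_abs]
    exact mul_le_mul (hwle a n) (hC n y) (abs_nonneg _) (by positivity)
  have hsum : ∀ a y, Summable fun n => w a n * g n y := fun a y =>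
    Summable.of_norm_bounded (hgeo.mul_right C) (hterm a y)
  let f : K → Q → ℝ := fun a y => ∑' n, w a n * g n y
  have hf : Continuous fun a => UniformFun.ofFun (f a) := by
    have hu := tendstoUniformly_tsum_nat (f := fun n (p : K × Q) => w p.1 n * g n p.2)
      (hgeo.mul_right C) (fun n p => hterm p.1 p.2 n)
    rw [continuous_iff_continuousAt]
    intro a
    rw [ContinuousAt, UniformFun.tendsto_iff_tendstoUniformly]
    rw [Metric.tendstoUniformly_iff] at hu ⊢
    intro ε hε
    obtain ⟨n, hn⟩ := (hu (ε / 4) (by positivity)).exists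
    have hCC : 0 ≤ C := (abs_nonneg _).trans (hC 0 (x 0))
    have hcont : Continuous fun b : K => ∑ i ∈ Finset.range n, |w b i - w a i| * C := by
      fun_prop
    have h0 := hcont.tendsto a
    simp only [sub_self, abs_zero, zero_mul, Finset.sum_const_zero] at h0
    filter_upwards [h0.eventually (gt_mem_nhds (show (0 : ℝ) < ε / 4 by positivity))] with b hb y
    have h1 := hn (a, y)
    have h2 := hn (b, y)
    have h3 : |∑ i ∈ Finset.range n, w b i * g i y - ∑ i ∈ Finset.range n, w a i * g i y|
        ≤ ∑ i ∈ Finset.range n, |w b i - w a i| * C := by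
      rw [← Finset.sum_sub_distrib]
      refine (Finset.abs_sum_le_sum_abs _ _).trans (Finset.sum_le_sum fun i _ => ?_)
      rw [← sub_mul, abs_mul]
      exact mul_le_mul_of_nonneg_left (hC i y) (abs_nonneg _)
    simp only [Real.dist_eq, Function.comp, UniformFun.toFun_ofFun] at h1 h2 ⊢
    simp only [f]
    rw [abs_lt] at h1 h2 ⊢
    rw [abs_le] at h3
    constructor <;> linarith [h1.1, h1.2, h2.1, h2.2, h3.1, h3.2]
  let T : ℕ → Set K := fun n => {a | ContinuousAt (f a) (x n)}
  have hTc : ∀ n, IsClosed (T n) := by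
    intro n
    rw [← isSeqClosed_iff_isClosed]
    intro a b ha hab
    have := (hf.tendsto b).comp hab
    rw [UniformFun.tendsto_iff_tendstoUniformly] at this
    refine continuousAt_of_locally_uniform_approx_of_continuousAt fun u hu => ?_
    obtain ⟨k, hk⟩ := (this u hu).exists
    exact ⟨Set.univ, univ_mem, f (a k), ha k, fun y _ => hk y⟩
  -- Changing only coordinate `n` adds a nonzero multiple of `g n`, so two such sums cannot both be
  -- continuous at `x n`.
  have hTd : ∀ n, Dense (T n)ᶜ := by
    intro n
    rw [← interior_eq_empty_iff_dense_compl, Set.eq_empty_iff_forall_notMem]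
    intro a ha
    have hup : Continuous fun c => Function.update a n c := continuous_const.update n continuous_id
    have hmem : ∀ᶠ c in 𝓝 (a n), Function.update a n c ∈ T n := by
      have h := hup.tendsto (a n)
      rw [Function.update_eq_self] at h
      exact h (mem_interior_iff_mem_nhds.1 ha)
    obtain ⟨c, hcT, hca⟩ : ∃ c, Function.update a n c ∈ T n ∧ c ≠ a n := by
      have hne : (𝓝[≠] (a n)).NeBot :=
        have : ConnectedSpace (Set.Icc (1 : ℝ) 2) :=
          Subtype.connectedSpace (isConnected_Icc one_le_two)
        have : Nontrivial (Set.Icc (1 : ℝ) 2) :=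
          ⟨⟨1, by norm_num⟩, ⟨2, by norm_num⟩, by simp⟩
        inferInstance
      obtain ⟨c, hc⟩ := ((hmem.filter_mono nhdsWithin_le_nhds).and
        (eventually_mem_nhdsWithin (a := a n) (s := {a n}ᶜ))).exists
      exact ⟨c, hc.1, hc.2⟩
    have haT : ContinuousAt (f a) (x n) := interior_subset ha
    have hdiff : ∀ y, f (Function.update a n c) y - f a y
        = ((c : ℝ) - a n) * (1 / 2) ^ n * g n y := by
      intro y
      simp only [f]
      rw [← (hsum _ y).tsum_sub (hsum a y), tsum_eq_single n]
      · simp only [w, Function.update_self]; ring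
      · intro m hm
        simp only [w, Function.update_of_ne hm, sub_self]
    have hne : ((c : ℝ) - a n) * (1 / 2) ^ n ≠ 0 :=
      mul_ne_zero (sub_ne_zero.2 fun h => hca (Subtype.ext h)) (by positivity)
    refine hx n ?_
    have h := (ContinuousAt.sub hcT haT).const_mul (((c : ℝ) - a n) * (1 / 2) ^ n)⁻¹
    refine h.congr (Eventually.of_forall fun y => ?_)
    simp only [Pi.sub_apply]
    rw [hdiff, inv_mul_cancel_left₀ hne]
  have hne : Nonempty K := ⟨fun _ => ⟨1, by norm_num⟩⟩
  obtain ⟨a, ha⟩ := (dense_iInter_of_isOpen (fun n => (hTc n).isOpen_compl) hTd).nonempty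
  exact ⟨w a, hwpos a, hwsum a, fun n => Set.mem_iInter.1 ha n⟩

/-- In the space of scatteredly continuous functions on a countably tight space, the members of
a uniformly bounded `σ`-convex set are simultaneously continuous on a nonempty open part. -/
theorem exists_isOpen_forall_continuousOn {X : Type u} [TopologicalSpace X]
    (hX : tightness X ≤ ℵ₀) {F : Set (X → ℝ)} (hF : F ⊆ SCp X) (hσ : IsSigmaConvex F)
    {A : Set X} (hA : A.Nonempty) {C : ℝ} (hC : ∀ f ∈ F, ∀ x ∈ A, |f x| ≤ C) :
    ∃ U : Set X, IsOpen U ∧ (U ∩ A).Nonempty ∧ ∀ f ∈ F, ContinuousOn f (U ∩ A) := by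
  by_contra! hcon
  let D : Set X := {x | x ∈ A ∧ ∃ f ∈ F, ¬ ContinuousWithinAt f A x}
  have hD : ∀ U, IsOpen U → (U ∩ A).Nonempty → (U ∩ D).Nonempty := by
    intro U hU hne
    obtain ⟨f, hf, hfc⟩ := hcon U hU hne
    simp only [ContinuousOn, not_forall] at hfc
    obtain ⟨x, hx, hfx⟩ := hfc
    exact ⟨x, hx.1, hx.2, f, hf, fun h => hfx (h.mono Set.inter_subset_right)⟩
  have step : ∀ x : X, ∃ f : X → ℝ, ∃ B : Set X, B.Countable ∧ (x ∈ D → f ∈ F ∧ B ⊆ D ∧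
      ∀ Q, B ⊆ Q → ¬ ContinuousWithinAt f Q x) := by
    intro x
    by_cases hx : x ∈ D
    · obtain ⟨hxA, f, hf, hfx⟩ := hx
      obtain ⟨ε, hε, hclos⟩ : ∃ ε > 0, x ∈ closure {y | y ∈ A ∧ ε < dist (f y) (f x)} := by
        by_contra! h
        refine hfx (Metric.tendsto_nhds.2 fun ε hε => ?_)
        have h1 := h (ε / 2) (by positivity)
        rw [mem_closure_iff_frequently, not_frequently] at h1
        rw [eventually_nhdsWithin_iff]
        filter_upwards [h1] with y hy hyA
        by_contra! h2
        exact hy ⟨hyA, by linarith⟩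
      -- At a continuity point `y` the strict inequality persists nearby in `A`, where `D` is dense;
      -- any other `y` is already in `D`.
      have hclos' : x ∈ closure ({y | y ∈ A ∧ ε < dist (f y) (f x)} ∩ D) := by
        refine closure_minimal ?_ isClosed_closure hclos
        rintro y ⟨hyA, hy⟩
        by_cases hyc : ContinuousWithinAt f A y
        · rw [mem_closure_iff]
          intro O hO hyO
          have hev : ∀ᶠ z in 𝓝[A] y, ε < dist (f z) (f x) :=
            (hyc.dist continuousWithinAt_const).eventually (lt_mem_nhds hy)
          obtain ⟨O', hO', hyO', hs⟩ := mem_nhdsWithin.1 hev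
          obtain ⟨z, hz, hzD⟩ := hD (O ∩ O') (hO.inter hO') ⟨y, ⟨hyO, hyO'⟩, hyA⟩
          exact ⟨z, hz.1, ⟨hzD.1, hs ⟨hz.2, hzD.1⟩⟩, hzD⟩
        · exact subset_closure ⟨⟨hyA, hy⟩, hyA, f, hf, hyc⟩
      obtain ⟨B, hBs, hBc, hxB⟩ := exists_countable_subset_mem_closure hX hclos'
      refine ⟨f, B, hBc, fun _ => ⟨hf, fun y hy => (hBs hy).2, fun Q hQ hcont => ?_⟩⟩
      have hev := (Metric.tendsto_nhds.1 hcont ε hε)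
      rw [eventually_nhdsWithin_iff] at hev
      obtain ⟨y, hyB, hy⟩ := ((mem_closure_iff_frequently.1 hxB).and_eventually hev).exists
      exact absurd (hy (hQ hyB)) (not_lt.2 (hBs hyB).1.2.le)
    · exact ⟨0, ∅, Set.countable_empty, fun h => absurd h hx⟩
  choose φ B hBc hstep using step
  obtain ⟨x₀, -, hx₀⟩ := hD Set.univ isOpen_univ (by simpa using hA)
  -- Closing `{x₀}` under `B` makes each `φ x` with `x ∈ Q` discontinuous at `x` already on the
  -- countable set `Q`.
  let R : ℕ → Set X := fun n => (fun s => ⋃ y ∈ s, B y)^[n] {x₀}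
  have hRs : ∀ n, R (n + 1) = ⋃ y ∈ R n, B y := fun n => Function.iterate_succ_apply' _ _ _
  have hRc : ∀ n, (R n).Countable := by
    intro n
    induction n with
    | zero => exact Set.countable_singleton _
    | succ n ih => rw [hRs]; exact ih.biUnion fun y _ => hBc y
  have hRD : ∀ n, R n ⊆ D := by
    intro n
    induction n with
    | zero => exact Set.singleton_subset_iff.2 hx₀
    | succ n ih => rw [hRs]; exact Set.iUnion₂_subset fun y hy => (hstep y (ih hy)).2.1
  let Q : Set X := ⋃ n, R n
  have hQD : Q ⊆ D := Set.iUnion_subset hRD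
  have hQne : Q.Nonempty := ⟨x₀, Set.mem_iUnion.2 ⟨0, rfl⟩⟩
  have hBQ : ∀ x ∈ Q, B x ⊆ Q := by
    intro x hx
    obtain ⟨n, hn⟩ := Set.mem_iUnion.1 hx
    refine subset_trans ?_ (Set.subset_iUnion R (n + 1))
    rw [hRs]
    exact Set.subset_biUnion_of_mem (u := B) hn
  have : Countable Q := (Set.countable_iUnion hRc).to_subtype
  have : Nonempty Q := hQne.to_subtype
  obtain ⟨q, hq⟩ := exists_surjective_nat Q
  obtain ⟨s, hs0, hss, hsd⟩ := exists_series_not_continuousAt (Q := Q) (C := C) (x := q)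
    (g := fun n y => φ (q n) y)
    (fun n y => hC _ (hstep _ (hQD (q n).2)).1 _ (hQD y.2).1)
    (fun n h => (hstep _ (hQD (q n).2)).2.2 Q (hBQ _ (q n).2)
      ((continuousWithinAt_iff_continuousAt_domRestrict _ (q n).2).2 h))
  have hS : 0 < ∑' n, s n := hss.tsum_pos (fun n => (hs0 n).le) 0 (hs0 0)
  obtain ⟨f, hfF, hf⟩ := hσ (fun n => φ (q n)) (fun n => s n / ∑' n, s n)
    (fun n => (hstep _ (hQD (q n).2)).1) (fun n => div_pos (hs0 n) hS)
    (by simpa [div_self hS.ne'] using hss.hasSum.div_const (∑' n, s n))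
  obtain ⟨y, hyQ, hy⟩ := hF hfF Q hQne
  obtain ⟨n, hn⟩ := hq ⟨y, hyQ⟩
  refine hsd n ?_
  rw [hn]
  have hy' := ((continuousWithinAt_iff_continuousAt_domRestrict f hyQ).1 hy).const_mul (∑' n, s n)
  refine hy'.congr (Eventually.of_forall fun z => ?_)
  have hsz : Summable fun i => s i * φ (q i) z :=
    Summable.of_norm_bounded (hss.mul_right C) fun i => by
      rw [norm_mul, Real.norm_of_nonneg (hs0 i).le]
      exact mul_le_mul_of_nonneg_left (hC _ (hstep _ (hQD (q i).2)).1 _ (hQD z.2).1) (hs0 i).le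
  have h1 := (tendsto_pi_nhds.1 hf z).const_mul (∑' n, s n)
  refine tendsto_nhds_unique h1 ?_
  convert hsz.hasSum.tendsto_sum_nat using 2 with k
  rw [Finset.sum_apply, Finset.mul_sum]
  refine Finset.sum_congr rfl fun i _ => ?_
  simp only [Pi.smul_apply, smul_eq_mul]
  field_simp

/-! ### Exhaustion by pieces of continuity -/

/-- If each nonempty subset of `Y` has a nonempty relatively open part on which all functions of
`F` are continuous, then `Y` is covered by `nw(X)` many sets with this property. -/
theorem exists_cover_forall_continuousOn {X : Type u} [TopologicalSpace X] {F : Set (X → ℝ)}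
    {Y : Set X} (h : ∀ A ⊆ Y, A.Nonempty →
      ∃ U : Set X, IsOpen U ∧ (U ∩ A).Nonempty ∧ ∀ f ∈ F, ContinuousOn f (U ∩ A)) :
    ∃ P : Set (Set X), #P ≤ networkWeight X ∧ Y ⊆ ⋃₀ P ∧
      ∀ p ∈ P, ∀ f ∈ F, ContinuousOn f p := by
  obtain ⟨h0, N, hN, hNc⟩ := aleph0_le_networkWeight_and_exists X
  let good : Set X → Prop := fun E => ∃ P : Set (Set X), #P ≤ networkWeight X ∧ E ⊆ ⋃₀ P ∧
      ∀ p ∈ P, ∀ f ∈ F, ContinuousOn f p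
  let O : Set X := {x | ∃ U, IsOpen U ∧ x ∈ U ∧ good (U ∩ Y)}
  -- One cover per member of the network suffices, even though `O` is a union of arbitrarily many
  -- open sets.
  obtain ⟨P, hPc, hPO, hP⟩ : good (O ∩ Y) := by
    have hch : ∀ S : N, ∃ P : Set (Set X), #P ≤ networkWeight X ∧
        (∀ p ∈ P, ∀ f ∈ F, ContinuousOn f p) ∧
        ∀ U, (S : Set X) ⊆ U → good (U ∩ Y) → (S : Set X) ∩ Y ⊆ ⋃₀ P := by
      intro S
      by_cases hS : ∃ U, (S : Set X) ⊆ U ∧ good (U ∩ Y)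
      · obtain ⟨U, hSU, P, hPc, hUP, hP⟩ := hS
        exact ⟨P, hPc, hP, fun _ _ _ => (Set.inter_subset_inter_left _ hSU).trans hUP⟩
      · exact ⟨∅, by simp, by simp, fun U h1 h2 => absurd ⟨U, h1, h2⟩ hS⟩
    choose P hPc hP hPU using hch
    refine ⟨⋃ S, P S, ?_, ?_, ?_⟩
    · exact (mk_iUnion_le_sum_mk).trans ((sum_le_mk_mul_iSup _).trans
        (mul_le_of_le h0 hNc (ciSup_le' hPc)))
    · rintro x ⟨⟨U, hU, hxU, hg⟩, hxY⟩
      obtain ⟨S, hS, hxS, hSU⟩ := hN x U hU hxU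
      obtain ⟨p, hp, hxp⟩ := hPU ⟨S, hS⟩ U hSU hg ⟨hxS, hxY⟩
      exact ⟨p, Set.mem_iUnion.2 ⟨_, hp⟩, hxp⟩
    · intro p hp
      obtain ⟨S, hS⟩ := Set.mem_iUnion.1 hp
      exact hP S p hS
  refine ⟨P, hPc, fun x hx => hPO ⟨?_, hx⟩, hP⟩
  by_contra hxO
  -- One more piece makes `U ∩ Y` good, which forces `y` into `O`.
  obtain ⟨U, hU, ⟨y, hyU, hyY, hyO⟩, hUc⟩ := h (Y \ O) Set.sdiff_subset ⟨x, hx, hxO⟩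
  refine hyO ⟨U, hU, hyU, insert (U ∩ (Y \ O)) P, ?_, ?_, ?_⟩
  · exact mk_insert_le.trans (add_le_of_le h0 hPc (one_le_aleph0.trans h0))
  · rintro z ⟨hzU, hzY⟩
    by_cases hzO : z ∈ O
    · obtain ⟨p, hp, hzp⟩ := hPO ⟨hzO, hzY⟩
      exact ⟨p, Set.mem_insert_of_mem _ hp, hzp⟩
    · exact ⟨_, Set.mem_insert _ _, hzU, hzY, hzO⟩
  · rintro p (rfl | hp)
    · exact hUc
    · exact hP p hp

theorem networkWeight_le_of_isSigmaConvex {X : Type u} [TopologicalSpace X]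
    (hX : tightness X ≤ ℵ₀) {F : Set (X → ℝ)} (hF : F ⊆ SCp X) (hσ : IsSigmaConvex F) :
    networkWeight F ≤ networkWeight X := by
  have h0 := (aleph0_le_networkWeight_and_exists X).1
  have hn : ∀ n : ℕ, ∃ P : Set (Set X), #P ≤ networkWeight X ∧
      {x | ∀ f ∈ F, |f x| ≤ n} ⊆ ⋃₀ P ∧ ∀ p ∈ P, ∀ f ∈ F, ContinuousOn f p := fun n =>
    exists_cover_forall_continuousOn fun A hA hne =>
      exists_isOpen_forall_continuousOn hX hF hσ hne fun f hf x hx => hA hx f hf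
  choose P hPc hcov hP using hn
  refine networkWeight_le_of_isInducing (φ := Subtype.val) IsInducing.subtypeVal le_rfl
    (P := ⋃ n : ULift.{u} ℕ, P n.down) ?_ ?_ ?_
  · refine mk_iUnion_le_sum_mk.trans ((sum_le_mk_mul_iSup _).trans
      (mul_le_of_le h0 (by simpa using h0) (ciSup_le' fun n => hPc n.down)))
  · intro x
    obtain ⟨n, hn⟩ := hσ.exists_abs_le x
    obtain ⟨p, hp, hxp⟩ := hcov n hn
    exact ⟨p, Set.mem_iUnion.2 ⟨⟨n⟩, hp⟩, hxp⟩
  · intro p hp f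
    obtain ⟨n, hn⟩ := Set.mem_iUnion.1 hp
    exact hP n.down p hn f f.2

/-! ### The unit ball of `C_p(X)` -/

theorem cpUnitBall_subset_SCp (X : Type u) [TopologicalSpace X] : cpUnitBall X ⊆ SCp X :=
  fun _ hf _ ⟨a, ha⟩ => ⟨a, ha, hf.1.continuousWithinAt⟩

theorem isSigmaConvex_cpUnitBall (X : Type u) [TopologicalSpace X] :
    IsSigmaConvex (cpUnitBall X) := by
  intro f t hf ht hsum
  have hb : ∀ n x, ‖t n * f n x‖ ≤ t n := fun n x => by
    rw [norm_mul, Real.norm_of_nonneg (ht n).le]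
    exact mul_le_of_le_one_right (ht n).le ((hf n).2 x)
  refine ⟨fun x => ∑' n, t n * f n x, ⟨continuous_tsum
    (fun n => continuous_const.mul (hf n).1) hsum.summable hb, fun x => ?_⟩, ?_⟩
  · rw [← Real.norm_eq_abs]
    exact tsum_of_norm_bounded hsum fun n => hb n x
  · refine tendsto_pi_nhds.2 fun x => ?_
    simpa using (Summable.of_norm_bounded hsum.summable fun n => hb n x).hasSum.tendsto_sum_nat

/-- The `[0,1]`-valued functions given by complete regularity lie in the ball and separate points
from closed sets. -/
theorem isInducing_eval_cpUnitBall (X : Type u) [TopologicalSpace X] [CompletelyRegularSpace X] :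
    IsInducing fun (x : X) (f : cpUnitBall X) => (f : X → ℝ) x := by
  have hcont : Continuous fun (x : X) (f : cpUnitBall X) => (f : X → ℝ) x :=
    continuous_pi fun f => f.2.1
  refine ⟨le_antisymm hcont.le_induced fun U hU => ?_⟩
  rw [@isOpen_iff_mem_nhds]
  intro x hx
  obtain ⟨g, hg, hgx, hgU⟩ := CompletelyRegularSpace.completely_regular x Uᶜ hU.isClosed_compl
    (not_not.2 hx)
  let f : cpUnitBall X := ⟨fun y => (g y : ℝ), continuous_subtype_val.comp hg, fun y => by
    rw [abs_of_nonneg (g y).2.1]; exact (g y).2.2⟩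
  rw [nhds_induced]
  refine mem_comap.2 ⟨{u | u f < 1}, (isOpen_lt (continuous_apply f) continuous_const).mem_nhds ?_,
    fun y hy => ?_⟩
  · simp [f, hgx]
  · by_contra hyU
    have : g y = 1 := hgU hyU
    simp [f, this] at hy

theorem networkWeight_cpUnitBall_ge (X : Type u) [TopologicalSpace X] [CompletelyRegularSpace X] :
    networkWeight X ≤ networkWeight (cpUnitBall X) :=
  networkWeight_le_of_isInducing (isInducing_eval_cpUnitBall X) le_rfl (P := {Set.univ})
    (by simpa using one_le_aleph0.trans (aleph0_le_networkWeight_and_exists (cpUnitBall X)).1)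
    (fun y => ⟨_, rfl, Set.mem_univ y⟩)
    (fun _ _ x => ((continuous_apply x).comp continuous_subtype_val).continuousOn)

theorem mainTheorem3 (X : Type u) [TopologicalSpace X] (hX : tightness X ≤ ℵ₀) :
    (∀ F : Set (X → ℝ), F ⊆ SCp X → IsSigmaConvex F → networkWeight F ≤ networkWeight X) ∧
    (T35Space X →
      IsGreatest {κ : Cardinal.{u} | ∃ F : Set (X → ℝ),
        F ⊆ SCp X ∧ IsSigmaConvex F ∧ networkWeight F = κ} (networkWeight X) ∧
      cpUnitBall X ⊆ SCp X ∧ IsSigmaConvex (cpUnitBall X) ∧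
      networkWeight (cpUnitBall X) = networkWeight X) := by
  have hle : ∀ F : Set (X → ℝ), F ⊆ SCp X → IsSigmaConvex F →
      networkWeight F ≤ networkWeight X :=
    fun F hF hσ => networkWeight_le_of_isSigmaConvex hX hF hσ
  refine ⟨hle, fun _ => ?_⟩
  have hsub := cpUnitBall_subset_SCp X
  have hconv := isSigmaConvex_cpUnitBall X
  have heq := (hle _ hsub hconv).antisymm (networkWeight_cpUnitBall_ge X)
  refine ⟨⟨⟨_, hsub, hconv, heq⟩, ?_⟩, hsub, hconv, heq⟩
  rintro κ ⟨F, hF, hσ, rfl⟩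
  exact hle F hF hσ
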